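/- For a finite group $G$ and a positive integer $k$, let $\rho_k(G)$ and $\rho_k^*(G)$ be the proportions of elements $g\in G$ whose order divides $k$, respectively equals $k$, and let $\epsilon_k=\sup\{\rho_k(G) : G \text{ a finite non-soluble group}\}$. We say that Deaconescu's conjecture *fails for $k$* if there is a finite non-soluble group $G$ with $\rho_k^*(G)\ge 1/2$. **Proposition.** Let $p$ be an odd prime and $q=p^n$ with $n\ge 1$. (1) The exponent of $\mathrm{PSL}_2(q)$ is $p(q+1)(q-1)/4$. (2) $$\rho_{(q-1)/2}(\mathrm{PSL}_2(q))=\frac{q(q+1)(q-3)/2+2}{(q-1)q(q+1)},\qquad \rho_{(q+1)/2}(\mathrm{PSL}_2(q))=\frac{q(q-1)^2/2+2}{(q-1)q(q+1)}.$$ In particular, for every $\delta>0$ there is a positive integer $M$ such that $\epsilon_{(q-1)/2}>1/2-\delta$ and $\epsilon_{(q+1)/2}>1/2-\delta$ for all odd prime powers $q>M$. (3) If $q\equiv 1 \pmod 4$, then $$\rho_{q+1}(\mathrm{PSL}_2(q))=\frac{q^3+3q+4}{2(q-1)q(q+1)}>\frac12.$$ In particular $\epsilon_{q+1}>1/2$,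 and the conjecture fails for $k=q+1$. (4) If $q\equiv 3\pmod 4$, then $$\rho_{q-1}(\mathrm{PSL}_2(q))=\frac{q^3-5q+4}{2(q-1)q(q+1)}<\frac12.$$ (5) $$\rho_{p(q-1)/2}(\mathrm{PSL}_2(q))=\frac{q(q^2+2q-3)}{2(q-1)q(q+1)}>\frac12,\qquad \rho_{p(q+1)/2}(\mathrm{PSL}_2(q))=\frac{q(q+1)^2}{2(q-1)q(q+1)}>\frac12,$$ $$\rho_{(q-1)(q+1)/4}(\mathrm{PSL}_2(q))=\frac{q-2}{q},$$ and the last number is greater than $1/2$ if $q\ge 5$. In particular $\epsilon_{p(q+1)/2}>1/2$ and the conjecture fails for $k=p(q+1)/2$; if $q\ge 5$, then also $\epsilon_{p(q-1)/2}>1/2$ and $\epsilon_{(q-1)(q+1)/4}>1/2$, and the conjecture fails for $k=p(q-1)/2$ and $k=(q-1)(q+1)/4$. -/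

import Mathlib

/-- `rho k G`: the proportion of the elements of `G` whose order divides `k`. -/
noncomputable def rho (k : ℕ) (G : Type*) [Group G] : ℝ :=
  (Nat.card {g : G // orderOf g ∣ k} : ℝ) / (Nat.card G : ℝ)

/-- `rhoStar k G`: the proportion of the elements of `G` whose order is exactly `k`. -/
noncomputable def rhoStar (k : ℕ) (G : Type*) [Group G] : ℝ :=
  (Nat.card {g : G // orderOf g = k} : ℝ) / (Nat.card G : ℝ)

/-- `eps k`: the supremum of `rho k G` over all finite non-soluble groups `G`.
Every finite group is isomorphic to one whose carrier lies in `Type`, and the set below is a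
non-empty set of numbers in `[0, 1]`, so this is the true supremum. -/
noncomputable def eps (k : ℕ) : ℝ :=
  sSup {r : ℝ | ∃ (G : Type) (_ : Group G), Finite G ∧ ¬ Group.IsSolvable G ∧ rho k G = r}

/-- Deaconescu's conjecture for a fixed `k`: a finite group in which at least half of the elements
have order `k` is soluble. -/
def DeaconescuConjecture (k : ℕ) : Prop :=
  ∀ (G : Type) [Group G] [Finite G], 1 / 2 ≤ rhoStar k G → Group.IsSolvable G

/-! Everything is computed in `SL(2, F)` and transferred to the quotient by the centre. The trace
`t` sorts matrices by the discriminant `t ^ 2 - 4` of the characteristic polynomial: zero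
(parabolic), nonzero square (split), nonsquare (non-split). Writing `q = 2 * m + 3`, the images in
`PSL(2, F)` have order dividing `p`, `m + 1 = (q - 1) / 2` and `m + 2 = (q + 1) / 2` respectively,
and these three numbers are pairwise coprime. The class sizes come from counting matrices of given
trace (`card_trace_eq`, `card_trace_partition`). The order bounds come from the Frobenius map
applied to `2 * g - t`, whose square is scalar (`two_smul_pow_card`), so neither diagonalization nor
an extension field is needed.

For each `k` in question, a class then contributes all its elements, only its central elements, or
only its trace-zero elements (the involutions); `rho_psl2` adds these up. The exponent is bounded
below because a central `k`-th power makes the trace a root of a polynomial of degree `k - 1`.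

Once a non-soluble `G` has `rho k G > 1 / 2`, multiplying by a large power of the cyclic group of
order `k` turns "order dividing `k`" into "order `k`" at arbitrarily small cost, which refutes the
conjecture for `k`. -/

open Matrix MatrixGroups

/-! ### Matrices of determinant one with prescribed trace -/

section Counting

variable {F : Type*} [Field F]

lemma card_mul_eq [Finite F] (m : F) [Decidable (m = 0)] :
    Nat.card {x : F × F // x.1 * x.2 = m} = Nat.card F - 1 + if m = 0 then Nat.card F else 0 := by
  classical
  have := Fintype.ofFinite F
  have e : {x : F × F // x.1 * x.2 = m} ≃ Σ b : F, {c : F // b * c = m} :=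
    { toFun := fun x => ⟨x.1.1, x.1.2, x.2⟩
      invFun := fun x => ⟨(x.1, x.2.1), x.2.2⟩
      left_inv := fun _ => rfl
      right_inv := fun _ => rfl }
  have h (b : F) : Nat.card {c : F // b * c = m} =
      if b = 0 then (if m = 0 then Nat.card F else 0) else 1 := by
    split_ifs with hb hm
    · subst hb hm
      exact Nat.card_congr (Equiv.subtypeUnivEquiv fun c => zero_mul c)
    · subst hb
      rw [Nat.card_eq_zero]
      exact Or.inl ⟨fun c => hm (by simpa using c.2.symm)⟩
    · rw [Nat.card_eq_one_iff_unique]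
      refine ⟨⟨fun c d => Subtype.ext (mul_left_cancel₀ hb (c.2.trans d.2.symm))⟩,
        ⟨⟨b⁻¹ * m, mul_inv_cancel_left₀ hb m⟩⟩⟩
  rw [Nat.card_congr e, Nat.card_sigma, Finset.sum_congr rfl fun b _ => h b,
    Finset.sum_ite, Finset.sum_const, Finset.sum_const, Finset.filter_eq' _ (0 : F),
    if_pos (Finset.mem_univ _), Finset.filter_ne' _ (0 : F),
    Finset.card_erase_of_mem (Finset.mem_univ _), Finset.card_univ, Nat.card_eq_fintype_card,
    Finset.card_singleton, one_smul, smul_eq_mul, mul_one, add_comm]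

lemma trace_sl2 (g : SL(2, F)) : (g : Matrix (Fin 2) (Fin 2) F).trace = g 0 0 + g 1 1 :=
  Matrix.trace_fin_two _

lemma det_sl2 (g : SL(2, F)) : g 0 0 * g 1 1 - g 0 1 * g 1 0 = 1 := by
  rw [← Matrix.det_fin_two]; exact g.2

/-- A matrix of determinant one and trace `t` is given by its diagonal entry `a` and two
off-diagonal entries with product `a * (t - a) - 1`. -/
def traceEquiv (t : F) :
    {g : SL(2, F) // (g : Matrix (Fin 2) (Fin 2) F).trace = t} ≃
    Σ a : F, {x : F × F // x.1 * x.2 = a * (t - a) - 1} where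
  toFun g := ⟨g.1 0 0, (g.1 0 1, g.1 1 0), by
    have h1 := trace_sl2 g.1
    have h2 := det_sl2 g.1
    rw [g.2] at h1
    simp only [h1]
    linear_combination -h2⟩
  invFun x := ⟨⟨!![x.1, x.2.1.1; x.2.1.2, t - x.1], by
    rw [Matrix.det_fin_two_of, x.2.2]; ring⟩, by simp [Matrix.trace_fin_two]⟩
  left_inv g := by
    have h1 := trace_sl2 g.1
    rw [g.2] at h1
    refine Subtype.ext (Matrix.SpecialLinearGroup.ext _ _ fun i j => ?_)
    fin_cases i <;> fin_cases j <;> simp [h1]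
  right_inv x := by
    rfl

/-- Each diagonal entry `a` leaves `q - 1` choices off the diagonal, plus `q` more when the
prescribed product `a * (t - a) - 1` vanishes, that is, when `a` is a root of the characteristic
polynomial. -/
lemma card_trace_eq [Finite F] (t : F) :
    Nat.card {g : SL(2, F) // (g : Matrix (Fin 2) (Fin 2) F).trace = t} =
    Nat.card F * (Nat.card F - 1) + Nat.card F * Nat.card {x : F // x ^ 2 - t * x + 1 = 0} := by
  classical
  have := Fintype.ofFinite F
  rw [Nat.card_congr (traceEquiv t), Nat.card_sigma,
    Finset.sum_congr rfl fun a _ => card_mul_eq (a * (t - a) - 1), Finset.sum_add_distrib,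
    Finset.sum_const, ← Finset.sum_filter, Finset.sum_const, Finset.card_univ,
    Nat.card_eq_fintype_card, smul_eq_mul, smul_eq_mul, mul_comm (Finset.card _)]
  congr 2
  rw [Nat.card_eq_fintype_card, Fintype.card_subtype]
  congr 1
  ext a
  simp only [Finset.mem_filter, Finset.mem_univ, true_and]
  constructor <;> intro h <;> linear_combination -h

/-- Every nonzero `x` is a root for exactly one trace, `x + x⁻¹`, and zero is never a root. -/
lemma sum_card_roots [Finite F] :
    ∑ᶠ t : F, Nat.card {x : F // x ^ 2 - t * x + 1 = 0} = Nat.card F - 1 := by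
  classical
  have := Fintype.ofFinite F
  rw [finsum_eq_sum_of_fintype, ← Nat.card_sigma, ← Nat.card_units]
  refine Nat.card_congr
    { toFun := fun x => Units.mk x.2.1 (x.1 - x.2.1) (by linear_combination -x.2.2)
        (by linear_combination -x.2.2)
      invFun := fun u => ⟨u + (u⁻¹ : Fˣ), u, by
        have := u.mul_inv
        linear_combination -this⟩
      left_inv := ?_
      right_inv := fun u => by ext; rfl }
  rintro ⟨t, x, hx⟩
  exact Sigma.subtype_ext (by simp) rfl

lemma card_roots_of_not_isSquare [NeZero (2 : F)] {t : F} (h : ¬ IsSquare (t ^ 2 - 4)) :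
    Nat.card {x : F // x ^ 2 - t * x + 1 = 0} = 0 := by
  rw [Nat.card_eq_zero]
  exact Or.inl ⟨fun x => h ⟨2 * x - t, by linear_combination -4 * x.2⟩⟩

lemma card_roots_of_isSquare [NeZero (2 : F)] {t : F} (h : IsSquare (t ^ 2 - 4))
    (h0 : t ^ 2 - 4 ≠ 0) : Nat.card {x : F // x ^ 2 - t * x + 1 = 0} = 2 := by
  obtain ⟨s, hs⟩ := h
  have h2 : (2 : F) ≠ 0 := NeZero.ne 2
  have hs0 : s ≠ 0 := by rintro rfl; simp [hs] at h0
  have : {x : F | x ^ 2 - t * x + 1 = 0} = {(t + s) / 2, (t - s) / 2} := by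
    ext x
    simp only [Set.mem_ofPred_eq, Set.mem_insert_iff, Set.mem_singleton_iff, eq_div_iff h2]
    constructor
    · intro hx
      have : (x * 2 - (t + s)) * (x * 2 - (t - s)) = 0 := by
        linear_combination 4 * hx + hs
      rcases mul_eq_zero.1 this with h | h
      · exact Or.inl (sub_eq_zero.1 h)
      · exact Or.inr (sub_eq_zero.1 h)
    · intro hx
      have : (2 * 2) * (x ^ 2 - t * x + 1) = 0 := by
        rcases hx with h | h
        · linear_combination (x * 2 - t + s) * h - hs
        · linear_combination (x * 2 - t - s) * h - hs
      exact (mul_eq_zero.1 this).resolve_left (mul_ne_zero h2 h2)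
  change Nat.card ({x : F | x ^ 2 - t * x + 1 = 0} : Set F) = 2
  rw [this, Nat.card_coe_set_eq, Set.ncard_pair]
  intro h
  rw [div_left_inj' h2] at h
  exact mul_ne_zero h2 hs0 (by linear_combination h)

lemma card_roots_of_eq_zero [NeZero (2 : F)] {t : F} (h0 : t ^ 2 - 4 = 0) :
    Nat.card {x : F // x ^ 2 - t * x + 1 = 0} = 1 := by
  have h2 : (2 : F) ≠ 0 := NeZero.ne 2
  rw [Nat.card_eq_one_iff_unique]
  have key (x : F) : x ^ 2 - t * x + 1 = 0 ↔ x = t / 2 := by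
    rw [eq_div_iff h2]
    constructor
    · intro hx
      have : (x * 2 - t) ^ 2 = 0 := by linear_combination 4 * hx + h0
      exact sub_eq_zero.1 (pow_eq_zero_iff two_ne_zero |>.1 this)
    · intro h
      have : (2 * 2) * (x ^ 2 - t * x + 1) = 0 := by linear_combination (x * 2 - t) * h - h0
      exact (mul_eq_zero.1 this).resolve_left (mul_ne_zero h2 h2)
  simp_rw [key]
  exact ⟨inferInstance, inferInstance⟩

end Counting

/-! ### Sizes of the parabolic, split and non-split classes -/

section Classes

variable {F : Type*} [Field F]

lemma card_trace_parabolic [NeZero (2 : F)] : Nat.card {t : F // t ^ 2 - 4 = 0} = 2 := by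
  have h2 : (2 : F) ≠ 0 := NeZero.ne 2
  have : {t : F | t ^ 2 - 4 = 0} = {2, -2} := by
    ext t
    simp only [Set.mem_ofPred_eq, Set.mem_insert_iff, Set.mem_singleton_iff]
    rw [show t ^ 2 - 4 = (t - 2) * (t + 2) by ring, mul_eq_zero, sub_eq_zero, add_eq_zero_iff_eq_neg]
  change Nat.card ({t : F | t ^ 2 - 4 = 0} : Set F) = 2
  rw [this, Nat.card_coe_set_eq, Set.ncard_pair]
  intro h
  exact mul_ne_zero h2 h2 (by linear_combination h)

/-- Counting pairs (trace, root) and counting traces gives two linear equations for the numbers of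
split and non-split traces. -/
lemma card_trace_partition [Finite F] [NeZero (2 : F)] :
    Nat.card {t : F // t ^ 2 - 4 ≠ 0 ∧ IsSquare (t ^ 2 - 4)} * 2 + 2 = Nat.card F - 1 ∧
    Nat.card {t : F // t ^ 2 - 4 ≠ 0 ∧ IsSquare (t ^ 2 - 4)} +
      Nat.card {t : F // ¬ IsSquare (t ^ 2 - 4)} + 2 = Nat.card F := by
  classical
  have := Fintype.ofFinite F
  have hr (t : F) : Nat.card {x : F // x ^ 2 - t * x + 1 = 0} =
      (if t ^ 2 - 4 ≠ 0 ∧ IsSquare (t ^ 2 - 4) then 2 else 0) +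
        if t ^ 2 - 4 = 0 then 1 else 0 := by
    by_cases h0 : t ^ 2 - 4 = 0
    · rw [card_roots_of_eq_zero h0]; simp [h0]
    · by_cases h : IsSquare (t ^ 2 - 4)
      · rw [card_roots_of_isSquare h h0]; simp [h0, h]
      · rw [card_roots_of_not_isSquare h]; simp [h0, h]
  have h1 (t : F) : 1 = (if t ^ 2 - 4 ≠ 0 ∧ IsSquare (t ^ 2 - 4) then 1 else 0) +
      (if ¬ IsSquare (t ^ 2 - 4) then 1 else 0) + if t ^ 2 - 4 = 0 then 1 else 0 := by
    by_cases h0 : t ^ 2 - 4 = 0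
    · simp [h0]
    · by_cases h : IsSquare (t ^ 2 - 4) <;> simp [h0, h]
  have e1 := sum_card_roots (F := F)
  have e2 : ∑ t : F, 1 = Nat.card F := by simp
  have e3 := card_trace_parabolic (F := F)
  rw [finsum_eq_sum_of_fintype, Finset.sum_congr rfl fun t _ => hr t, Finset.sum_add_distrib] at e1
  rw [Finset.sum_congr rfl fun t _ => h1 t, Finset.sum_add_distrib, Finset.sum_add_distrib] at e2
  rw [Nat.card_eq_fintype_card, Fintype.card_subtype] at e3
  simp only [Finset.sum_ite, Finset.sum_const, smul_eq_mul, mul_one, mul_zero, add_zero, e3]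
    at e1 e2
  rw [Nat.card_eq_fintype_card, Fintype.card_subtype, Nat.card_eq_fintype_card (α := {t : F // _}),
    Fintype.card_subtype]
  exact ⟨e1, e2⟩

lemma card_trace_mem [Finite F] (P : F → Prop) (r : ℕ)
    (hr : ∀ t, P t → Nat.card {x : F // x ^ 2 - t * x + 1 = 0} = r) :
    Nat.card {g : SL(2, F) // P (g : Matrix (Fin 2) (Fin 2) F).trace} =
      Nat.card {t // P t} * (Nat.card F * (Nat.card F - 1) + Nat.card F * r) := by
  classical
  have := Fintype.ofFinite F
  have e : {g : SL(2, F) // P (g : Matrix (Fin 2) (Fin 2) F).trace} ≃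
      Σ t : {t // P t}, {g : SL(2, F) // (g : Matrix (Fin 2) (Fin 2) F).trace = t} :=
    { toFun := fun g => ⟨⟨_, g.2⟩, g.1, rfl⟩
      invFun := fun g => ⟨g.2.1, by rw [g.2.2]; exact g.1.2⟩
      left_inv := fun g => rfl
      right_inv := fun g => Sigma.subtype_ext (Subtype.ext g.2.2) rfl }
  have : Finite {t // P t} := inferInstance
  rw [Nat.card_congr e, Nat.card_sigma, Finset.sum_congr rfl fun t _ => by
    rw [card_trace_eq, hr _ t.2], Finset.sum_const, Finset.card_univ, smul_eq_mul,
    ← Nat.card_eq_fintype_card]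

lemma card_parabolic [Finite F] [NeZero (2 : F)] :
    Nat.card {g : SL(2, F) // (g : Matrix (Fin 2) (Fin 2) F).trace ^ 2 - 4 = 0} =
      2 * Nat.card F ^ 2 := by
  rw [card_trace_mem (fun t => t ^ 2 - 4 = 0) 1 fun t h => card_roots_of_eq_zero h,
    card_trace_parabolic]
  obtain ⟨m, hm⟩ := Nat.exists_eq_add_of_lt (Nat.card_pos (α := F))
  rw [hm, Nat.zero_add, Nat.add_sub_cancel]
  ring

lemma card_split [Finite F] [NeZero (2 : F)] {m : ℕ} (hm : Nat.card F = 2 * m + 3) :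
    Nat.card {g : SL(2, F) // (g : Matrix (Fin 2) (Fin 2) F).trace ^ 2 - 4 ≠ 0 ∧
      IsSquare ((g : Matrix (Fin 2) (Fin 2) F).trace ^ 2 - 4)} =
      m * (Nat.card F * (Nat.card F + 1)) := by
  rw [card_trace_mem (fun t => t ^ 2 - 4 ≠ 0 ∧ IsSquare (t ^ 2 - 4)) 2
    fun t h => card_roots_of_isSquare h.2 h.1]
  have h := (card_trace_partition (F := F)).1
  rw [hm] at h ⊢
  rw [show Nat.card {t : F // t ^ 2 - 4 ≠ 0 ∧ IsSquare (t ^ 2 - 4)} = m by omega,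
    show 2 * m + 3 - 1 = 2 * m + 2 by omega]
  ring

lemma card_nonsplit [Finite F] [NeZero (2 : F)] {m : ℕ} (hm : Nat.card F = 2 * m + 3) :
    Nat.card {g : SL(2, F) // ¬ IsSquare ((g : Matrix (Fin 2) (Fin 2) F).trace ^ 2 - 4)} =
      (m + 1) * (Nat.card F * (Nat.card F - 1)) := by
  rw [card_trace_mem (fun t => ¬ IsSquare (t ^ 2 - 4)) 0
    fun t h => card_roots_of_not_isSquare h]
  have h := (card_trace_partition (F := F))
  rw [hm] at h ⊢
  rw [show Nat.card {t : F // ¬ IsSquare (t ^ 2 - 4)} = m + 1 by omega,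
    show 2 * m + 3 - 1 = 2 * m + 2 by omega]
  ring

lemma card_subtype_trichotomy [Finite F] (P : SL(2, F) → Prop) :
    Nat.card {g : SL(2, F) // P g} =
      Nat.card {g : SL(2, F) // (g : Matrix (Fin 2) (Fin 2) F).trace ^ 2 - 4 = 0 ∧ P g} +
      Nat.card {g : SL(2, F) // ((g : Matrix (Fin 2) (Fin 2) F).trace ^ 2 - 4 ≠ 0 ∧
        IsSquare ((g : Matrix (Fin 2) (Fin 2) F).trace ^ 2 - 4)) ∧ P g} +
      Nat.card {g : SL(2, F) // ¬ IsSquare ((g : Matrix (Fin 2) (Fin 2) F).trace ^ 2 - 4) ∧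
        P g} := by
  classical
  have := Fintype.ofFinite SL(2, F)
  simp only [Nat.card_eq_fintype_card, Fintype.card_subtype]
  rw [← Finset.card_union_of_disjoint, ← Finset.card_union_of_disjoint]
  · congr 1
    ext g
    simp only [Finset.mem_filter, Finset.mem_union, Finset.mem_univ, true_and]
    tauto
  · rw [← Finset.filter_or, Finset.disjoint_filter]
    rintro g - (⟨h, -⟩ | ⟨h, -⟩) ⟨h', -⟩
    · rw [h] at h'; exact h' IsSquare.zero
    · exact h' h.2
  · rw [Finset.disjoint_filter]
    rintro g - ⟨h, -⟩ ⟨h', -⟩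
    exact h'.1 h

lemma card_sl2 [Finite F] [NeZero (2 : F)] {m : ℕ} (hm : Nat.card F = 2 * m + 3) :
    Nat.card SL(2, F) = Nat.card F * (Nat.card F - 1) * (Nat.card F + 1) := by
  have := card_subtype_trichotomy (F := F) (fun _ => True)
  simp only [and_true] at this
  rw [Nat.card_congr (Equiv.subtypeUnivEquiv fun _ => trivial), card_parabolic, card_split hm,
    card_nonsplit hm, hm, show 2 * m + 3 - 1 = 2 * m + 2 by omega] at this
  rw [this, hm, show 2 * m + 3 - 1 = 2 * m + 2 by omega]
  ring

end Classes

/-! ### Powers via Cayley–Hamilton and Frobenius -/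

section PowersOfMatrices

variable {F : Type*} [Field F]

lemma sl2_sq (g : SL(2, F)) : (g : Matrix (Fin 2) (Fin 2) F) ^ 2 =
    (g : Matrix (Fin 2) (Fin 2) F).trace • (g : Matrix (Fin 2) (Fin 2) F) - 1 := by
  have h := det_sl2 g
  rw [trace_sl2, sq]
  ext i j
  fin_cases i <;> fin_cases j <;>
    simp [Matrix.mul_apply, Fin.sum_univ_two] <;> first | ring1 | linear_combination -h

lemma mem_center_of_smul_eq {g : SL(2, F)} {a b : F} (ha : a ≠ 0)
    (h : a • (g : Matrix (Fin 2) (Fin 2) F) = b • 1) : g ∈ Subgroup.center SL(2, F) := by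
  have hg : (g : Matrix (Fin 2) (Fin 2) F) = scalar (Fin 2) (a⁻¹ * b) := by
    rw [← inv_smul_smul₀ ha (g : Matrix (Fin 2) (Fin 2) F), h, smul_smul, scalar_apply,
      smul_one_eq_diagonal]
  refine Matrix.SpecialLinearGroup.mem_center_iff.2 ⟨a⁻¹ * b, ?_, hg.symm⟩
  have h1 := g.2
  rw [hg] at h1
  simpa using h1

lemma mem_center_iff_eq_smul (g : SL(2, F)) : g ∈ Subgroup.center SL(2, F) ↔
    ∃ ε : F, ε ^ 2 = 1 ∧ (g : Matrix (Fin 2) (Fin 2) F) = ε • 1 := by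
  rw [Matrix.SpecialLinearGroup.mem_center_iff]
  simp only [Fintype.card_fin, scalar_apply, smul_one_eq_diagonal, eq_comm]

/-- By Cayley–Hamilton the trace times `h` is the scalar `2`, so the trace is nonzero and `h` is
scalar. This is what halves the orders `q ± 1` on passing to `PSL(2, F)`. -/
lemma mem_center_of_sq_eq_one [NeZero (2 : F)] {h : SL(2, F)} (hh : h ^ 2 = 1) :
    h ∈ Subgroup.center SL(2, F) := by
  have h2 : (2 : F) ≠ 0 := NeZero.ne 2
  have e := sl2_sq h
  rw [← Matrix.SpecialLinearGroup.coe_pow, hh, Matrix.SpecialLinearGroup.coe_one] at e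
  have e' : (h : Matrix (Fin 2) (Fin 2) F).trace • (h : Matrix (Fin 2) (Fin 2) F) =
      (2 : F) • 1 := by
    rw [two_smul]; nth_rewrite 1 [e]; abel
  refine mem_center_of_smul_eq (fun h0 => ?_) e'
  rw [h0, zero_smul] at e'
  have := congrFun (congrFun e' 0) 0
  simp at this
  exact h2 this.symm

lemma mem_center_of_sq_eq_smul {h : SL(2, F)} {ε : F}
    (hh : (h : Matrix (Fin 2) (Fin 2) F) ^ 2 = ε • 1)
    (ht : (h : Matrix (Fin 2) (Fin 2) F).trace ≠ 0) : h ∈ Subgroup.center SL(2, F) := by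
  rw [sl2_sq] at hh
  refine mem_center_of_smul_eq (b := ε + 1) ht ?_
  rw [add_smul, one_smul, ← hh]; abel

lemma trace_of_mem_center {g : SL(2, F)} (hg : g ∈ Subgroup.center SL(2, F)) :
    (g : Matrix (Fin 2) (Fin 2) F).trace ^ 2 - 4 = 0 := by
  obtain ⟨ε, hε, h⟩ := (mem_center_iff_eq_smul g).1 hg
  rw [h, trace_smul, trace_one]
  simp
  linear_combination 4 * hε

lemma two_smul_sub_trace_sq (g : SL(2, F)) :
    ((2 : F) • (g : Matrix (Fin 2) (Fin 2) F) -
      (g : Matrix (Fin 2) (Fin 2) F).trace • 1) ^ 2 =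
    ((g : Matrix (Fin 2) (Fin 2) F).trace ^ 2 - 4) • 1 := by
  have h := sl2_sq g
  set M := (g : Matrix (Fin 2) (Fin 2) F)
  rw [sq, sub_mul, mul_sub, mul_sub]
  simp only [smul_mul_assoc, mul_smul_comm, one_mul, mul_one]
  rw [← sq, h]
  module

lemma two_smul_sub_trace_pow (p : ℕ) [Fact p.Prime] [CharP F p] (k : ℕ) (g : SL(2, F)) :
    ((2 : F) • (g : Matrix (Fin 2) (Fin 2) F) -
      (g : Matrix (Fin 2) (Fin 2) F).trace • 1) ^ p ^ k =
    (2 : F) • (g : Matrix (Fin 2) (Fin 2) F) ^ p ^ k -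
      ((g : Matrix (Fin 2) (Fin 2) F).trace ^ p ^ k) • 1 := by
  rw [sub_pow_expChar_pow_of_commute (p := p), smul_pow, smul_pow, one_pow]
  · congr 2
    -- The coefficient `2` survives because Frobenius is a ring homomorphism and so fixes numerals.
    have := map_ofNat (iterateFrobenius F p k) 2
    rwa [iterateFrobenius_def] at this
  · exact (Commute.one_right _).smul_right _

/-- With discriminant zero, `2 * g - t` squares to zero, so its `p`-th power `2 * g ^ p - t ^ p`
vanishes. -/
lemma pow_char_mem_center (p : ℕ) [Fact p.Prime] [CharP F p] [NeZero (2 : F)] {g : SL(2, F)}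
    (hg : (g : Matrix (Fin 2) (Fin 2) F).trace ^ 2 - 4 = 0) :
    g ^ p ∈ Subgroup.center SL(2, F) := by
  have h := two_smul_sub_trace_pow p 1 g
  have h0 := two_smul_sub_trace_sq g
  rw [hg, zero_smul] at h0
  rw [pow_one, pow_eq_zero_of_le (Nat.Prime.two_le Fact.out) h0] at h
  refine mem_center_of_smul_eq (b := (g : Matrix (Fin 2) (Fin 2) F).trace ^ p)
    (NeZero.ne (2 : F)) (sub_eq_zero.1 ?_)
  rw [Matrix.SpecialLinearGroup.coe_pow]
  exact h.symm

/-- Compute the `q`-th power of `N = 2 * g - t` twice: by Frobenius, and as an odd power of a matrix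
with scalar square. The quadratic character of the discriminant then decides between `g ^ q = g` and
`g ^ q = t - g = g⁻¹`. -/
lemma two_smul_pow_card [Finite F] [NeZero (2 : F)] (g : SL(2, F)) :
    (2 : F) • (g : Matrix (Fin 2) (Fin 2) F) ^ Nat.card F =
      (g : Matrix (Fin 2) (Fin 2) F).trace • 1 +
        ((g : Matrix (Fin 2) (Fin 2) F).trace ^ 2 - 4) ^ (Nat.card F / 2) •
          ((2 : F) • (g : Matrix (Fin 2) (Fin 2) F) -
            (g : Matrix (Fin 2) (Fin 2) F).trace • 1) := by
  have := Fintype.ofFinite F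
  obtain ⟨p, hp, n, hpp, hn⟩ := FiniteField.card' F
  have := Fact.mk hpp
  have hF : ringChar F ≠ 2 := by
    intro h
    exact NeZero.ne (2 : F) ((ringChar.spec F 2).2 h.dvd)
  have h := two_smul_sub_trace_pow p n g
  rw [← hn, FiniteField.pow_card, ← Nat.card_eq_fintype_card] at h
  rw [← sub_eq_iff_eq_add', ← h]
  have hodd : 2 * (Nat.card F / 2) + 1 = Nat.card F := by
    rw [Nat.card_eq_fintype_card]
    have := FiniteField.odd_card_of_char_ne_two hF
    omega
  nth_rewrite 1 [← hodd]
  rw [pow_succ, pow_mul, two_smul_sub_trace_sq, smul_pow, one_pow, smul_one_mul]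

lemma isSquare_iff_pow_eq_one [Finite F] [NeZero (2 : F)] {a : F} (ha : a ≠ 0) :
    IsSquare a ↔ a ^ (Nat.card F / 2) = 1 := by
  have := Fintype.ofFinite F
  rw [Nat.card_eq_fintype_card]
  exact FiniteField.isSquare_iff (fun h => NeZero.ne (2 : F) ((ringChar.spec F 2).2 h.dvd)) ha

lemma pow_eq_neg_one_of_not_isSquare [Finite F] [NeZero (2 : F)] {a : F} (ha : ¬ IsSquare a) :
    a ^ (Nat.card F / 2) = -1 := by
  have h0 : a ≠ 0 := by rintro rfl; exact ha IsSquare.zero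
  have := Fintype.ofFinite F
  rw [isSquare_iff_pow_eq_one h0, Nat.card_eq_fintype_card] at ha
  rw [Nat.card_eq_fintype_card]
  exact (FiniteField.pow_dichotomy
    (fun h => NeZero.ne (2 : F) ((ringChar.spec F 2).2 h.dvd)) h0).resolve_left ha

lemma pow_card_sub_one_of_isSquare [Finite F] [NeZero (2 : F)] {g : SL(2, F)}
    (h0 : (g : Matrix (Fin 2) (Fin 2) F).trace ^ 2 - 4 ≠ 0)
    (hg : IsSquare ((g : Matrix (Fin 2) (Fin 2) F).trace ^ 2 - 4)) :
    g ^ (Nat.card F - 1) = 1 := by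
  have h := two_smul_pow_card g
  rw [(isSquare_iff_pow_eq_one h0).1 hg, one_smul, add_sub_cancel] at h
  have h' := smul_right_injective _ (NeZero.ne (2 : F)) h
  have h'' : g ^ Nat.card F = g := Subtype.ext ((Matrix.SpecialLinearGroup.coe_pow _ _).trans h')
  rw [pow_sub g Nat.card_pos, h'', pow_one, mul_inv_cancel]

lemma pow_card_add_one_of_not_isSquare [Finite F] [NeZero (2 : F)] {g : SL(2, F)}
    (hg : ¬ IsSquare ((g : Matrix (Fin 2) (Fin 2) F).trace ^ 2 - 4)) :
    g ^ (Nat.card F + 1) = 1 := by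
  have h := two_smul_pow_card g
  have hs := sl2_sq g
  rw [pow_eq_neg_one_of_not_isSquare hg] at h
  have h' : (2 : F) • (g : Matrix (Fin 2) (Fin 2) F) ^ Nat.card F =
      (2 : F) • ((g : Matrix (Fin 2) (Fin 2) F).trace • 1 - (g : Matrix (Fin 2) (Fin 2) F)) := by
    rw [h]; module
  have h'' := smul_right_injective _ (NeZero.ne (2 : F)) h'
  refine Subtype.ext ((Matrix.SpecialLinearGroup.coe_pow _ _).trans ?_)
  rw [pow_succ, h'', sub_mul, ← sq, hs, smul_one_mul, sub_sub_cancel]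
  rfl

/-- Powers of a `2 × 2` matrix of determinant one are given by polynomials in its trace. -/
lemma exists_polynomial_pow_succ (k : ℕ) : ∃ P Q : Polynomial F, P.Monic ∧ P.natDegree = k ∧
    Q.natDegree ≤ k ∧ ∀ g : SL(2, F), (g : Matrix (Fin 2) (Fin 2) F) ^ (k + 1) =
      P.eval (g : Matrix (Fin 2) (Fin 2) F).trace • (g : Matrix (Fin 2) (Fin 2) F) -
        Q.eval (g : Matrix (Fin 2) (Fin 2) F).trace • 1 := by
  induction k with
  | zero => exact ⟨1, 0, Polynomial.monic_one, by simp, by simp, by simp⟩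
  | succ k ih =>
    obtain ⟨P, Q, hP, hPk, hQ, h⟩ := ih
    have hd : (Polynomial.X * P).natDegree = k + 1 := by
      rw [Polynomial.monic_X.natDegree_mul hP, Polynomial.natDegree_X, hPk, add_comm]
    have hlt : Q.natDegree < (Polynomial.X * P).natDegree := by omega
    refine ⟨Polynomial.X * P - Q, P,
      (Polynomial.monic_X.mul hP).sub_of_left (Polynomial.degree_lt_degree hlt), ?_, by omega,
      fun g => ?_⟩
    · rw [Polynomial.natDegree_sub_eq_left_of_natDegree_lt hlt, hd]
    · have hs := sl2_sq g
      rw [pow_succ, h, sub_mul, smul_mul_assoc, ← sq, hs, smul_one_mul]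
      simp only [Polynomial.eval_sub, Polynomial.eval_mul, Polynomial.eval_X]
      module

/-- If the coefficient of `g` in `g ^ k` were nonzero, a scalar `g ^ k` would force `g` to be
scalar, contradicting a nonzero discriminant. Hence all these traces are roots of one monic
polynomial of degree `k - 1`. -/
lemma card_trace_le_of_pow_mem_center [Finite F] (P : F → Prop) {k : ℕ} (hk : k ≠ 0)
    (hP : ∀ t, P t → t ^ 2 - 4 ≠ 0)
    (h : ∀ g : SL(2, F), P (g : Matrix (Fin 2) (Fin 2) F).trace →
      g ^ k ∈ Subgroup.center SL(2, F)) :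
    Nat.card {t // P t} < k := by
  classical
  have := Fintype.ofFinite F
  obtain ⟨k, rfl⟩ := Nat.exists_eq_succ_of_ne_zero hk
  obtain ⟨S, T, hS, hSk, -, hpow⟩ := exists_polynomial_pow_succ (F := F) k
  have hroot (t : F) (ht : P t) : S.IsRoot t := by
    -- The companion matrix realizes the trace `t`.
    let g : SL(2, F) := ⟨!![0, -1; 1, t], by simp [Matrix.det_fin_two_of]⟩
    have htr : (g : Matrix (Fin 2) (Fin 2) F).trace = t := by simp [g, Matrix.trace_fin_two]
    by_contra hne
    obtain ⟨ε, -, hε⟩ := (mem_center_iff_eq_smul _).1 (h g (htr.symm ▸ ht))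
    rw [Matrix.SpecialLinearGroup.coe_pow, Nat.succ_eq_add_one, hpow, htr] at hε
    refine hP t ht ?_
    rw [← htr]
    refine trace_of_mem_center (mem_center_of_smul_eq (b := ε + T.eval t) hne ?_)
    rw [add_smul, ← hε]; abel
  rw [Nat.card_eq_fintype_card, Fintype.card_subtype, Nat.lt_succ_iff, ← hSk]
  refine (Finset.card_le_card fun t ht => ?_).trans
    ((Multiset.toFinset_card_le _).trans (Polynomial.card_roots' S))
  rw [Multiset.mem_toFinset, Polynomial.mem_roots hS.ne_zero]
  exact hroot t (Finset.mem_filter.1 ht).2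

end PowersOfMatrices

/-! ### Orders in `PSL(2, F)`, and its exponent -/

section Orders

variable {F : Type*} [Field F]

lemma coprime_succ_succ (m : ℕ) : (m + 1).Coprime (m + 2) := by
  rw [show m + 2 = 1 + (m + 1) by omega, Nat.coprime_add_self_right]
  exact Nat.coprime_one_right _

lemma orderOf_mk_dvd_iff {G : Type*} [Group G] (N : Subgroup G) [N.Normal] (g : G) (k : ℕ) :
    orderOf (g : G ⧸ N) ∣ k ↔ g ^ k ∈ N := by
  rw [orderOf_dvd_iff_pow_eq_one, ← QuotientGroup.mk_pow, QuotientGroup.eq_one_iff]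

lemma card_orderOf_dvd_quotient {G : Type*} [Group G] (N : Subgroup G) [N.Normal] (k : ℕ) :
    Nat.card {g : G // orderOf (g : G ⧸ N) ∣ k} =
      Nat.card N * Nat.card {x : G ⧸ N // orderOf x ∣ k} :=
  QuotientGroup.card_preimage_mk N {x | orderOf x ∣ k}

/-- All fibres of the quotient map have the same size, so proportions can be counted upstairs. -/
lemma rho_quotient {G : Type*} [Group G] [Finite G] (N : Subgroup G) [N.Normal] (k : ℕ) :
    rho k (G ⧸ N) = Nat.card {g : G // orderOf (g : G ⧸ N) ∣ k} / Nat.card G := by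
  have h : (Nat.card N : ℝ) ≠ 0 := Nat.cast_ne_zero.2 Nat.card_pos.ne'
  rw [rho, card_orderOf_dvd_quotient, Subgroup.card_eq_card_quotient_mul_card_subgroup N,
    mul_comm (Nat.card (G ⧸ N)), Nat.cast_mul, Nat.cast_mul, mul_div_mul_left _ _ h]

lemma card_center_sl2 [NeZero (2 : F)] :
    Nat.card {g : SL(2, F) // g ∈ Subgroup.center SL(2, F)} = 2 := by
  have h2 : (2 : F) ≠ 0 := NeZero.ne 2
  have : {g : SL(2, F) | g ∈ Subgroup.center SL(2, F)} = {1, -1} := by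
    ext g
    simp only [Set.mem_ofPred_eq, Set.mem_insert_iff, Set.mem_singleton_iff,
      mem_center_iff_eq_smul, sq_eq_one_iff]
    constructor
    · rintro ⟨ε, rfl | rfl, h⟩
      · exact Or.inl (Subtype.ext (by simpa using h))
      · exact Or.inr (Subtype.ext (by simpa using h))
    · rintro (rfl | rfl)
      · exact ⟨1, Or.inl rfl, by simp⟩
      · exact ⟨-1, Or.inr rfl, by simp⟩
  change Nat.card ({g : SL(2, F) | g ∈ Subgroup.center SL(2, F)} : Set _) = 2
  rw [this, Nat.card_coe_set_eq, Set.ncard_pair]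
  intro h
  have := congrArg (fun g : SL(2, F) => g 0 0) h
  simp at this
  exact h2 (by linear_combination this)

lemma orderOf_mk_dvd_char (p : ℕ) [Fact p.Prime] [CharP F p] [NeZero (2 : F)] {g : SL(2, F)}
    (hg : (g : Matrix (Fin 2) (Fin 2) F).trace ^ 2 - 4 = 0) :
    orderOf (g : PSL(2, F)) ∣ p :=
  (orderOf_mk_dvd_iff _ _ _).2 (pow_char_mem_center p hg)

variable [Finite F] [NeZero (2 : F)] {m : ℕ}

lemma orderOf_mk_dvd_of_isSquare (hm : Nat.card F = 2 * m + 3) {g : SL(2, F)}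
    (h : (g : Matrix (Fin 2) (Fin 2) F).trace ^ 2 - 4 ≠ 0 ∧
      IsSquare ((g : Matrix (Fin 2) (Fin 2) F).trace ^ 2 - 4)) :
    orderOf (g : PSL(2, F)) ∣ m + 1 := by
  have e := pow_card_sub_one_of_isSquare h.1 h.2
  rw [hm, show 2 * m + 3 - 1 = (m + 1) * 2 by omega, pow_mul] at e
  exact (orderOf_mk_dvd_iff _ _ _).2 (mem_center_of_sq_eq_one e)

lemma orderOf_mk_dvd_of_not_isSquare (hm : Nat.card F = 2 * m + 3) {g : SL(2, F)}
    (h : ¬ IsSquare ((g : Matrix (Fin 2) (Fin 2) F).trace ^ 2 - 4)) :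
    orderOf (g : PSL(2, F)) ∣ m + 2 := by
  have e := pow_card_add_one_of_not_isSquare h
  rw [hm, show 2 * m + 3 + 1 = (m + 2) * 2 by omega, pow_mul] at e
  exact (orderOf_mk_dvd_iff _ _ _).2 (mem_center_of_sq_eq_one e)

omit [Finite F] [NeZero (2 : F)] in
lemma not_mem_center_of_isSquare {g : SL(2, F)}
    (h : (g : Matrix (Fin 2) (Fin 2) F).trace ^ 2 - 4 ≠ 0 ∧
      IsSquare ((g : Matrix (Fin 2) (Fin 2) F).trace ^ 2 - 4)) :
    g ∉ Subgroup.center SL(2, F) := fun hg => h.1 (trace_of_mem_center hg)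

omit [Finite F] [NeZero (2 : F)] in
lemma not_mem_center_of_not_isSquare {g : SL(2, F)}
    (h : ¬ IsSquare ((g : Matrix (Fin 2) (Fin 2) F).trace ^ 2 - 4)) :
    g ∉ Subgroup.center SL(2, F) := fun hg => by
  rw [trace_of_mem_center hg] at h; exact h IsSquare.zero

omit [Finite F] [NeZero (2 : F)] in
lemma orderOf_mk_eq_one_iff {g : SL(2, F)} :
    orderOf (g : PSL(2, F)) = 1 ↔ g ∈ Subgroup.center SL(2, F) := by
  rw [orderOf_eq_one_iff, QuotientGroup.eq_one_iff]

omit [Finite F] [NeZero (2 : F)] in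
-- Since `g ^ 2 = t * g - 1`, a non-scalar `g` has scalar square only if `t = 0`.
lemma orderOf_mk_dvd_two_iff {g : SL(2, F)} (hg : g ∉ Subgroup.center SL(2, F)) :
    orderOf (g : PSL(2, F)) ∣ 2 ↔ (g : Matrix (Fin 2) (Fin 2) F).trace = 0 := by
  rw [orderOf_mk_dvd_iff]
  constructor
  · intro h
    obtain ⟨ε, -, hε⟩ := (mem_center_iff_eq_smul _).1 h
    rw [Matrix.SpecialLinearGroup.coe_pow] at hε
    by_contra ht
    exact hg (mem_center_of_sq_eq_smul hε ht)
  · intro h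
    refine (mem_center_iff_eq_smul _).2 ⟨-1, by ring, ?_⟩
    rw [Matrix.SpecialLinearGroup.coe_pow, sl2_sq, h]
    simp

omit [Finite F] in
lemma card_parabolic_orderOf_dvd_of_coprime (p : ℕ) [Fact p.Prime] [CharP F p] {k : ℕ}
    (hk : p.Coprime k) :
    Nat.card {g : SL(2, F) // (g : Matrix (Fin 2) (Fin 2) F).trace ^ 2 - 4 = 0 ∧
      orderOf (g : PSL(2, F)) ∣ k} = 2 := by
  refine Eq.trans (Nat.card_congr (Equiv.subtypeEquivRight fun g => ⟨fun h => ?_, fun h => ?_⟩))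
    (card_center_sl2 (F := F))
  · exact orderOf_mk_eq_one_iff.1 (Nat.eq_one_of_dvd_coprimes hk (orderOf_mk_dvd_char p h.1) h.2)
  · exact ⟨trace_of_mem_center h, orderOf_mk_eq_one_iff.2 h ▸ one_dvd k⟩

lemma card_parabolic_orderOf_dvd_of_dvd (p : ℕ) [Fact p.Prime] [CharP F p] {k : ℕ}
    (hk : p ∣ k) :
    Nat.card {g : SL(2, F) // (g : Matrix (Fin 2) (Fin 2) F).trace ^ 2 - 4 = 0 ∧
      orderOf (g : PSL(2, F)) ∣ k} = 2 * Nat.card F ^ 2 := by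
  rw [← card_parabolic (F := F)]
  exact Nat.card_congr (Equiv.subtypeEquivRight fun g =>
    and_iff_left_of_imp fun h => (orderOf_mk_dvd_char p h).trans hk)

lemma card_split_orderOf_dvd_of_dvd (hm : Nat.card F = 2 * m + 3) {k : ℕ} (hk : m + 1 ∣ k) :
    Nat.card {g : SL(2, F) // ((g : Matrix (Fin 2) (Fin 2) F).trace ^ 2 - 4 ≠ 0 ∧
      IsSquare ((g : Matrix (Fin 2) (Fin 2) F).trace ^ 2 - 4)) ∧ orderOf (g : PSL(2, F)) ∣ k} =
      m * (Nat.card F * (Nat.card F + 1)) := by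
  rw [← card_split hm]
  exact Nat.card_congr (Equiv.subtypeEquivRight fun g =>
    and_iff_left_of_imp fun h => (orderOf_mk_dvd_of_isSquare hm h).trans hk)

lemma card_nonsplit_orderOf_dvd_of_dvd (hm : Nat.card F = 2 * m + 3) {k : ℕ} (hk : m + 2 ∣ k) :
    Nat.card {g : SL(2, F) // ¬ IsSquare ((g : Matrix (Fin 2) (Fin 2) F).trace ^ 2 - 4) ∧
      orderOf (g : PSL(2, F)) ∣ k} = (m + 1) * (Nat.card F * (Nat.card F - 1)) := by
  rw [← card_nonsplit hm]
  exact Nat.card_congr (Equiv.subtypeEquivRight fun g =>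
    and_iff_left_of_imp fun h => (orderOf_mk_dvd_of_not_isSquare hm h).trans hk)

lemma card_split_orderOf_dvd_of_coprime (hm : Nat.card F = 2 * m + 3) {k : ℕ}
    (hk : (m + 1).Coprime k) :
    Nat.card {g : SL(2, F) // ((g : Matrix (Fin 2) (Fin 2) F).trace ^ 2 - 4 ≠ 0 ∧
      IsSquare ((g : Matrix (Fin 2) (Fin 2) F).trace ^ 2 - 4)) ∧ orderOf (g : PSL(2, F)) ∣ k} =
      0 := by
  rw [Nat.card_eq_zero]
  exact Or.inl ⟨fun g => not_mem_center_of_isSquare g.2.1 (orderOf_mk_eq_one_iff.1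
    (Nat.eq_one_of_dvd_coprimes hk (orderOf_mk_dvd_of_isSquare hm g.2.1) g.2.2))⟩

lemma card_nonsplit_orderOf_dvd_of_coprime (hm : Nat.card F = 2 * m + 3) {k : ℕ}
    (hk : (m + 2).Coprime k) :
    Nat.card {g : SL(2, F) // ¬ IsSquare ((g : Matrix (Fin 2) (Fin 2) F).trace ^ 2 - 4) ∧
      orderOf (g : PSL(2, F)) ∣ k} = 0 := by
  rw [Nat.card_eq_zero]
  exact Or.inl ⟨fun g => not_mem_center_of_not_isSquare g.2.1 (orderOf_mk_eq_one_iff.1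
    (Nat.eq_one_of_dvd_coprimes hk (orderOf_mk_dvd_of_not_isSquare hm g.2.1) g.2.2))⟩

/-- As `-4` is the discriminant at trace zero, this decides whether the involutions are split or
non-split. -/
lemma isSquare_neg_four_iff : IsSquare (-4 : F) ↔ Nat.card F % 4 ≠ 3 := by
  have := Fintype.ofFinite F
  have h2 : (2 : F) ≠ 0 := NeZero.ne 2
  rw [Nat.card_eq_fintype_card, ← FiniteField.isSquare_neg_one_iff]
  constructor
  · rintro ⟨s, hs⟩
    refine ⟨s / 2, ?_⟩
    field_simp
    linear_combination hs
  · rintro ⟨s, hs⟩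
    exact ⟨2 * s, by linear_combination 4 * hs⟩

lemma card_split_orderOf_dvd_of_gcd_eq_two (hm : Nat.card F = 2 * m + 3) {k : ℕ}
    (h4 : Nat.card F % 4 = 1) (hk : (m + 1).gcd k = 2) :
    Nat.card {g : SL(2, F) // ((g : Matrix (Fin 2) (Fin 2) F).trace ^ 2 - 4 ≠ 0 ∧
      IsSquare ((g : Matrix (Fin 2) (Fin 2) F).trace ^ 2 - 4)) ∧ orderOf (g : PSL(2, F)) ∣ k} =
      Nat.card F * (Nat.card F + 1) := by
  have h2 : (2 : F) ≠ 0 := NeZero.ne 2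
  have hsq : (0 : F) ^ 2 - 4 ≠ 0 ∧ IsSquare ((0 : F) ^ 2 - 4) := by
    constructor
    · rw [show (0 : F) ^ 2 - 4 = - (2 * 2) by norm_num]
      exact neg_ne_zero.2 (mul_ne_zero h2 h2)
    · rw [show (0 : F) ^ 2 - 4 = - 4 by norm_num, isSquare_neg_four_iff]
      omega
  trans Nat.card {g : SL(2, F) // (g : Matrix (Fin 2) (Fin 2) F).trace = 0}
  · refine Nat.card_congr (Equiv.subtypeEquivRight fun g => ⟨fun h => ?_, fun h => ?_⟩)
    · rw [← orderOf_mk_dvd_two_iff (not_mem_center_of_isSquare h.1)]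
      exact (Nat.dvd_gcd (orderOf_mk_dvd_of_isSquare hm h.1) h.2).trans hk.dvd
    · have hg : (g : Matrix (Fin 2) (Fin 2) F).trace ^ 2 - 4 ≠ 0 ∧
          IsSquare ((g : Matrix (Fin 2) (Fin 2) F).trace ^ 2 - 4) := by rwa [h]
      refine ⟨hg, ((orderOf_mk_dvd_two_iff (not_mem_center_of_isSquare hg)).2 h).trans ?_⟩
      exact hk ▸ Nat.gcd_dvd_right _ _
  · rw [card_trace_eq, card_roots_of_isSquare hsq.2 hsq.1, hm,
      show 2 * m + 3 - 1 = 2 * m + 2 by omega]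
    ring

lemma card_nonsplit_orderOf_dvd_of_gcd_eq_two (hm : Nat.card F = 2 * m + 3) {k : ℕ}
    (h4 : Nat.card F % 4 = 3) (hk : (m + 2).gcd k = 2) :
    Nat.card {g : SL(2, F) // ¬ IsSquare ((g : Matrix (Fin 2) (Fin 2) F).trace ^ 2 - 4) ∧
      orderOf (g : PSL(2, F)) ∣ k} = Nat.card F * (Nat.card F - 1) := by
  have hsq : ¬ IsSquare ((0 : F) ^ 2 - 4) := by
    rw [show (0 : F) ^ 2 - 4 = - 4 by norm_num, isSquare_neg_four_iff]
    omega
  trans Nat.card {g : SL(2, F) // (g : Matrix (Fin 2) (Fin 2) F).trace = 0}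
  · refine Nat.card_congr (Equiv.subtypeEquivRight fun g => ⟨fun h => ?_, fun h => ?_⟩)
    · rw [← orderOf_mk_dvd_two_iff (not_mem_center_of_not_isSquare h.1)]
      exact (Nat.dvd_gcd (orderOf_mk_dvd_of_not_isSquare hm h.1) h.2).trans hk.dvd
    · rw [← h] at hsq
      refine ⟨hsq, ((orderOf_mk_dvd_two_iff (not_mem_center_of_not_isSquare hsq)).2 h).trans ?_⟩
      exact hk ▸ Nat.gcd_dvd_right _ _
  · rw [card_trace_eq, card_roots_of_not_isSquare hsq, mul_zero, add_zero]

/-- The proportion of elements of order dividing `k` in `PSL₂` is obtained by summing over the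
parabolic, split and non-split elements of `SL₂`. -/
lemma rho_psl2 (hm : Nat.card F = 2 * m + 3) (k : ℕ) {a b c : ℕ}
    (ha : Nat.card {g : SL(2, F) // (g : Matrix (Fin 2) (Fin 2) F).trace ^ 2 - 4 = 0 ∧
      orderOf (g : PSL(2, F)) ∣ k} = a)
    (hb : Nat.card {g : SL(2, F) // ((g : Matrix (Fin 2) (Fin 2) F).trace ^ 2 - 4 ≠ 0 ∧
      IsSquare ((g : Matrix (Fin 2) (Fin 2) F).trace ^ 2 - 4)) ∧ orderOf (g : PSL(2, F)) ∣ k} = b)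
    (hc : Nat.card {g : SL(2, F) // ¬ IsSquare ((g : Matrix (Fin 2) (Fin 2) F).trace ^ 2 - 4) ∧
      orderOf (g : PSL(2, F)) ∣ k} = c) :
    rho k PSL(2, F) = (a + b + c) /
      (((Nat.card F : ℝ) - 1) * Nat.card F * (Nat.card F + 1)) := by
  rw [rho_quotient, card_subtype_trichotomy, ha, hb, hc, card_sl2 hm]
  push_cast [Nat.cast_sub (Nat.card_pos (α := F))]
  rw [mul_comm ((Nat.card F : ℝ) - 1)]

/-- The exponent of `PSL₂` over a finite field of odd order. -/
lemma exponent_psl2 (p : ℕ) [Fact p.Prime] [CharP F p] (hm : Nat.card F = 2 * m + 3)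
    (hp : p.Coprime ((m + 1) * (m + 2))) :
    Monoid.exponent PSL(2, F) = p * ((m + 1) * (m + 2)) := by
  have hcop := coprime_succ_succ m
  have hpart := card_trace_partition (F := F)
  set e := Monoid.exponent PSL(2, F) with he
  have he0 : e ≠ 0 := Monoid.exponent_ne_zero_of_finite
  have hdvd (g : SL(2, F)) : orderOf (g : PSL(2, F)) ∣ e := Monoid.order_dvd_exponent _
  refine Nat.dvd_antisymm ?_ (hp.mul_dvd_of_dvd_of_dvd ?_ (hcop.mul_dvd_of_dvd_of_dvd ?_ ?_))
  · rw [he, Monoid.exponent_dvd]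
    intro x
    obtain ⟨g, rfl⟩ := QuotientGroup.mk_surjective x
    by_cases h0 : (g : Matrix (Fin 2) (Fin 2) F).trace ^ 2 - 4 = 0
    · exact (orderOf_mk_dvd_char p h0).trans (Nat.dvd_mul_right _ _)
    · refine Dvd.dvd.mul_left ?_ p
      by_cases h : IsSquare ((g : Matrix (Fin 2) (Fin 2) F).trace ^ 2 - 4)
      · exact (orderOf_mk_dvd_of_isSquare hm ⟨h0, h⟩).trans (Nat.dvd_mul_right _ _)
      · exact (orderOf_mk_dvd_of_not_isSquare hm h).trans (Nat.dvd_mul_left _ _)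
  -- Otherwise only the two central elements would be parabolic, but there are `2 * q ^ 2` parabolic
  -- elements.
  · by_contra hpe
    have hcp := card_parabolic_orderOf_dvd_of_coprime (F := F) p (k := e)
      ((Nat.Prime.coprime_iff_not_dvd Fact.out).2 hpe)
    rw [Nat.card_congr (Equiv.subtypeEquivRight fun g => and_iff_left (hdvd g)), card_parabolic,
      hm] at hcp
    nlinarith
  -- The gcd annihilates all split elements. Their `m` traces force it to exceed `m`, so it equals
  -- `m + 1`; the non-split case, with `m + 1` traces, is analogous.
  · have hlt := card_trace_le_of_pow_mem_center (F := F) (k := (m + 1).gcd e)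
      (fun t => t ^ 2 - 4 ≠ 0 ∧ IsSquare (t ^ 2 - 4))
      (Nat.gcd_pos_of_pos_left _ (Nat.succ_pos m)).ne' (fun t h => h.1) fun g hg =>
      (orderOf_mk_dvd_iff _ _ _).1 (Nat.dvd_gcd (orderOf_mk_dvd_of_isSquare hm hg) (hdvd g))
    have := Nat.gcd_le_left e (show 0 < m + 1 by omega)
    exact Nat.gcd_eq_left_iff_dvd.1 (by omega)
  · have hlt := card_trace_le_of_pow_mem_center (F := F) (k := (m + 2).gcd e)
      (fun t => ¬ IsSquare (t ^ 2 - 4))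
      (Nat.gcd_pos_of_pos_left _ (Nat.succ_pos _)).ne' (fun t h h0 => h (h0 ▸ IsSquare.zero))
      fun g hg =>
      (orderOf_mk_dvd_iff _ _ _).1 (Nat.dvd_gcd (orderOf_mk_dvd_of_not_isSquare hm hg) (hdvd g))
    have := Nat.gcd_le_left e (show 0 < m + 2 by omega)
    exact Nat.gcd_eq_left_iff_dvd.1 (by omega)

end Orders

/-! ### The proportions for each `k` -/

section Values

lemma exists_eq_two_mul_add_three {p n q : ℕ} (hp : p.Prime) (hp2 : p ≠ 2) (hn : 1 ≤ n)
    (hq : q = p ^ n) : ∃ m, q = 2 * m + 3 ∧ p.Coprime ((m + 1) * (m + 2)) := by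
  have hodd : Odd q := hq ▸ (hp.odd_of_ne_two hp2).pow
  have hpq : p ∣ q := hq ▸ dvd_pow_self p (by omega)
  have h3 : 3 ≤ q := by
    have := Nat.le_of_dvd hodd.pos hpq
    have := hp.two_le
    omega
  obtain ⟨j, hj⟩ := hodd
  refine ⟨j - 1, by omega, Nat.Coprime.mul_right ?_ ?_⟩ <;>
    rw [hp.coprime_iff_not_dvd] <;> intro h <;> apply hp.one_lt.ne' <;> rw [← Nat.dvd_one]
  · have := Nat.dvd_sub hpq (h.mul_left 2)
    rwa [show q - 2 * (j - 1 + 1) = 1 by omega] at this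
  · have := Nat.dvd_sub (h.mul_left 2) hpq
    rwa [show 2 * (j - 1 + 2) - q = 1 by omega] at this

variable {F : Type*} [Field F] [Finite F] {m : ℕ}

lemma neZero_two_of_card_odd (hm : Nat.card F = 2 * m + 3) : NeZero (2 : F) := by
  refine ⟨fun h => ?_⟩
  have := Fintype.ofFinite F
  have := FiniteField.cast_card_eq_zero F
  rw [← Nat.card_eq_fintype_card, hm] at this
  push_cast at this
  exact one_ne_zero (α := F) (by linear_combination this - (m + 1) * h)

variable {p : ℕ} [Fact p.Prime] [CharP F p]

include p in
lemma rho_psl2_half_card_sub_one (hm : Nat.card F = 2 * m + 3)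
    (hp : p.Coprime ((m + 1) * (m + 2))) :
    rho (m + 1) PSL(2, F) = ((Nat.card F : ℝ) * (Nat.card F + 1) * (Nat.card F - 3) / 2 + 2) /
      (((Nat.card F : ℝ) - 1) * Nat.card F * (Nat.card F + 1)) := by
  have := neZero_two_of_card_odd hm
  rw [rho_psl2 hm _ (card_parabolic_orderOf_dvd_of_coprime p hp.coprime_mul_right_right)
    (card_split_orderOf_dvd_of_dvd hm dvd_rfl)
    (card_nonsplit_orderOf_dvd_of_coprime hm (coprime_succ_succ m).symm)]
  congr 1
  push_cast [hm]
  ring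

include p in
lemma rho_psl2_half_card_add_one (hm : Nat.card F = 2 * m + 3)
    (hp : p.Coprime ((m + 1) * (m + 2))) :
    rho (m + 2) PSL(2, F) = ((Nat.card F : ℝ) * (Nat.card F - 1) ^ 2 / 2 + 2) /
      (((Nat.card F : ℝ) - 1) * Nat.card F * (Nat.card F + 1)) := by
  have := neZero_two_of_card_odd hm
  rw [rho_psl2 hm _ (card_parabolic_orderOf_dvd_of_coprime p hp.coprime_mul_left_right)
    (card_split_orderOf_dvd_of_coprime hm (coprime_succ_succ m))
    (card_nonsplit_orderOf_dvd_of_dvd hm dvd_rfl)]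
  congr 1
  push_cast [hm, show 2 * m + 3 - 1 = 2 * m + 2 by omega]
  ring

include p in
lemma rho_psl2_card_add_one (hp2 : p ≠ 2) (hm : Nat.card F = 2 * m + 3)
    (hp : p.Coprime ((m + 1) * (m + 2))) (h4 : Nat.card F % 4 = 1) :
    rho (2 * (m + 2)) PSL(2, F) = ((Nat.card F : ℝ) ^ 3 + 3 * Nat.card F + 4) /
      (2 * ((Nat.card F : ℝ) - 1) * Nat.card F * (Nat.card F + 1)) := by
  have := neZero_two_of_card_odd hm
  -- Here `q % 4 = 1` makes `m` odd, so `m + 1` is even and coprime to `m + 2`.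
  have hgcd : (m + 1).gcd (2 * (m + 2)) = 2 := by
    rw [(coprime_succ_succ m).symm.gcd_mul_right_cancel_right]
    exact Nat.gcd_eq_right (by omega)
  rw [rho_psl2 hm _ (card_parabolic_orderOf_dvd_of_coprime p
      (Nat.Coprime.mul_right ((Nat.coprime_primes Fact.out Nat.prime_two).2 hp2)
        hp.coprime_mul_left_right))
    (card_split_orderOf_dvd_of_gcd_eq_two hm h4 hgcd)
    (card_nonsplit_orderOf_dvd_of_dvd hm (Nat.dvd_mul_left _ _)), mul_assoc 2, mul_assoc 2,
    ← div_div _ (2 : ℝ)]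
  congr 1
  push_cast [hm, show 2 * m + 3 - 1 = 2 * m + 2 by omega]
  ring

include p in
lemma rho_psl2_card_sub_one (hp2 : p ≠ 2) (hm : Nat.card F = 2 * m + 3)
    (hp : p.Coprime ((m + 1) * (m + 2))) (h4 : Nat.card F % 4 = 3) :
    rho (2 * (m + 1)) PSL(2, F) = ((Nat.card F : ℝ) ^ 3 - 5 * Nat.card F + 4) /
      (2 * ((Nat.card F : ℝ) - 1) * Nat.card F * (Nat.card F + 1)) := by
  have := neZero_two_of_card_odd hm
  have hgcd : (m + 2).gcd (2 * (m + 1)) = 2 := by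
    rw [(coprime_succ_succ m).gcd_mul_right_cancel_right]
    exact Nat.gcd_eq_right (by omega)
  rw [rho_psl2 hm _ (card_parabolic_orderOf_dvd_of_coprime p
      (Nat.Coprime.mul_right ((Nat.coprime_primes Fact.out Nat.prime_two).2 hp2)
        hp.coprime_mul_right_right))
    (card_split_orderOf_dvd_of_dvd hm (Nat.dvd_mul_left _ _))
    (card_nonsplit_orderOf_dvd_of_gcd_eq_two hm h4 hgcd), mul_assoc 2, mul_assoc 2,
    ← div_div _ (2 : ℝ)]
  congr 1
  push_cast [hm, show 2 * m + 3 - 1 = 2 * m + 2 by omega]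
  ring

lemma rho_psl2_char_mul_half_card_sub_one (hm : Nat.card F = 2 * m + 3)
    (hp : p.Coprime ((m + 1) * (m + 2))) :
    rho (p * (m + 1)) PSL(2, F) =
      ((Nat.card F : ℝ) * ((Nat.card F : ℝ) ^ 2 + 2 * Nat.card F - 3)) /
      (2 * ((Nat.card F : ℝ) - 1) * Nat.card F * (Nat.card F + 1)) := by
  have := neZero_two_of_card_odd hm
  rw [rho_psl2 hm _ (card_parabolic_orderOf_dvd_of_dvd p (Nat.dvd_mul_right _ _))
    (card_split_orderOf_dvd_of_dvd hm (Nat.dvd_mul_left _ _))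
    (card_nonsplit_orderOf_dvd_of_coprime hm
      (Nat.Coprime.mul_right hp.coprime_mul_left_right.symm (coprime_succ_succ m).symm)),
    mul_assoc 2, mul_assoc 2, ← div_div _ (2 : ℝ)]
  congr 1
  push_cast [hm]
  ring

lemma rho_psl2_char_mul_half_card_add_one (hm : Nat.card F = 2 * m + 3)
    (hp : p.Coprime ((m + 1) * (m + 2))) :
    rho (p * (m + 2)) PSL(2, F) = ((Nat.card F : ℝ) * ((Nat.card F : ℝ) + 1) ^ 2) /
      (2 * ((Nat.card F : ℝ) - 1) * Nat.card F * (Nat.card F + 1)) := by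
  have := neZero_two_of_card_odd hm
  rw [rho_psl2 hm _ (card_parabolic_orderOf_dvd_of_dvd p (Nat.dvd_mul_right _ _))
    (card_split_orderOf_dvd_of_coprime hm
      (Nat.Coprime.mul_right hp.coprime_mul_right_right.symm (coprime_succ_succ m)))
    (card_nonsplit_orderOf_dvd_of_dvd hm (Nat.dvd_mul_left _ _)),
    mul_assoc 2, mul_assoc 2, ← div_div _ (2 : ℝ)]
  congr 1
  push_cast [hm, show 2 * m + 3 - 1 = 2 * m + 2 by omega]
  ring

include p in
lemma rho_psl2_semisimple (hm : Nat.card F = 2 * m + 3)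
    (hp : p.Coprime ((m + 1) * (m + 2))) :
    rho ((m + 1) * (m + 2)) PSL(2, F) = ((Nat.card F : ℝ) - 2) / Nat.card F := by
  have := neZero_two_of_card_odd hm
  rw [rho_psl2 hm _ (card_parabolic_orderOf_dvd_of_coprime p hp)
    (card_split_orderOf_dvd_of_dvd hm (Nat.dvd_mul_right _ _))
    (card_nonsplit_orderOf_dvd_of_dvd hm (Nat.dvd_mul_left _ _))]
  have h0 : (0 : ℝ) ≤ m := Nat.cast_nonneg m
  push_cast [hm, show 2 * m + 3 - 1 = 2 * m + 2 by omega]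
  rw [div_eq_div_iff (mul_pos (mul_pos (by linarith) (by linarith)) (by linarith)).ne'
    (by linarith)]
  ring

end Values

/-! ### Comparison with one half -/

section Sharp

lemma one_half_lt_of_three {x : ℝ} (hx : 3 ≤ x) :
    1 / 2 < (x ^ 3 + 3 * x + 4) / (2 * (x - 1) * x * (x + 1)) := by
  have h : 0 < 2 * (x - 1) * x * (x + 1) :=
    mul_pos (mul_pos (by linarith) (by linarith)) (by linarith)
  rw [div_lt_div_iff₀ two_pos h]
  nlinarith

lemma lt_one_half_of_three {x : ℝ} (hx : 3 ≤ x) :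
    (x ^ 3 - 5 * x + 4) / (2 * (x - 1) * x * (x + 1)) < 1 / 2 := by
  have h : 0 < 2 * (x - 1) * x * (x + 1) :=
    mul_pos (mul_pos (by linarith) (by linarith)) (by linarith)
  rw [div_lt_div_iff₀ h two_pos]
  nlinarith

lemma one_half_lt_char_mul_sub {x : ℝ} (hx : 3 ≤ x) :
    1 / 2 < (x * (x ^ 2 + 2 * x - 3)) / (2 * (x - 1) * x * (x + 1)) := by
  have h : 0 < 2 * (x - 1) * x * (x + 1) :=
    mul_pos (mul_pos (by linarith) (by linarith)) (by linarith)
  rw [div_lt_div_iff₀ two_pos h]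
  nlinarith

lemma one_half_lt_char_mul_add {x : ℝ} (hx : 3 ≤ x) :
    1 / 2 < (x * (x + 1) ^ 2) / (2 * (x - 1) * x * (x + 1)) := by
  have h : 0 < 2 * (x - 1) * x * (x + 1) :=
    mul_pos (mul_pos (by linarith) (by linarith)) (by linarith)
  rw [div_lt_div_iff₀ two_pos h]
  nlinarith

lemma one_half_lt_semisimple {x : ℝ} (hx : 5 ≤ x) : 1 / 2 < (x - 2) / x := by
  rw [div_lt_div_iff₀ two_pos (by linarith)]
  linarith

end Sharp

/-- Kept separate for its universe polymorphism: it serves arbitrary fields as well as the Galois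
fields in `Type` needed for `eps`. -/
theorem psl2_values (p n q : ℕ) (hp : p.Prime) (hp2 : p ≠ 2) (hn : 1 ≤ n) (hq : q = p ^ n)
    (F : Type*) [Field F] [Finite F] (hF : Nat.card F = q) :
        Monoid.exponent (Matrix.ProjectiveSpecialLinearGroup (Fin 2) F)
            = p * (q + 1) * (q - 1) / 4 ∧
        rho ((q - 1) / 2) (Matrix.ProjectiveSpecialLinearGroup (Fin 2) F)
            = ((q : ℝ) * (q + 1) * (q - 3) / 2 + 2) / (((q : ℝ) - 1) * q * (q + 1)) ∧
        rho ((q + 1) / 2) (Matrix.ProjectiveSpecialLinearGroup (Fin 2) F)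
            = ((q : ℝ) * (q - 1) ^ 2 / 2 + 2) / (((q : ℝ) - 1) * q * (q + 1)) ∧
        (q % 4 = 1 →
          rho (q + 1) (Matrix.ProjectiveSpecialLinearGroup (Fin 2) F)
            = ((q : ℝ) ^ 3 + 3 * q + 4) / (2 * ((q : ℝ) - 1) * q * (q + 1)) ∧
          1 / 2 < rho (q + 1) (Matrix.ProjectiveSpecialLinearGroup (Fin 2) F)) ∧
        (q % 4 = 3 →
          rho (q - 1) (Matrix.ProjectiveSpecialLinearGroup (Fin 2) F)
            = ((q : ℝ) ^ 3 - 5 * q + 4) / (2 * ((q : ℝ) - 1) * q * (q + 1)) ∧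
          rho (q - 1) (Matrix.ProjectiveSpecialLinearGroup (Fin 2) F) < 1 / 2) ∧
        rho (p * (q - 1) / 2) (Matrix.ProjectiveSpecialLinearGroup (Fin 2) F)
            = ((q : ℝ) * ((q : ℝ) ^ 2 + 2 * q - 3)) / (2 * ((q : ℝ) - 1) * q * (q + 1)) ∧
        1 / 2 < rho (p * (q - 1) / 2) (Matrix.ProjectiveSpecialLinearGroup (Fin 2) F) ∧
        rho (p * (q + 1) / 2) (Matrix.ProjectiveSpecialLinearGroup (Fin 2) F)
            = ((q : ℝ) * ((q : ℝ) + 1) ^ 2) / (2 * ((q : ℝ) - 1) * q * (q + 1)) ∧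
        1 / 2 < rho (p * (q + 1) / 2) (Matrix.ProjectiveSpecialLinearGroup (Fin 2) F) ∧
        rho ((q - 1) * (q + 1) / 4) (Matrix.ProjectiveSpecialLinearGroup (Fin 2) F)
            = ((q : ℝ) - 2) / q ∧
        (5 ≤ q →
          1 / 2 < rho ((q - 1) * (q + 1) / 4)
            (Matrix.ProjectiveSpecialLinearGroup (Fin 2) F)) := by
  obtain ⟨m, hm, hcop⟩ := exists_eq_two_mul_add_three hp hp2 hn hq
  have := Fact.mk hp
  have := Fintype.ofFinite F
  have : CharP F p := charP_of_card_eq_prime_pow (f := n)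
    (by rw [← Nat.card_eq_fintype_card, hF, hq])
  have hx : (3 : ℝ) ≤ q := by rw [hm]; push_cast; linarith [Nat.cast_nonneg (α := ℝ) m]
  have hFm := hF.trans hm
  have := neZero_two_of_card_odd hFm
  have e1 : (q - 1) / 2 = m + 1 := by omega
  have e2 : (q + 1) / 2 = m + 2 := by omega
  have e3 : p * (q - 1) / 2 = p * (m + 1) := by
    rw [Nat.mul_div_assoc _ (by omega), e1]
  have e4 : p * (q + 1) / 2 = p * (m + 2) := by
    rw [Nat.mul_div_assoc _ (by omega), e2]
  have e5 : (q - 1) * (q + 1) / 4 = (m + 1) * (m + 2) := by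
    rw [show q - 1 = 2 * (m + 1) by omega, show q + 1 = 2 * (m + 2) by omega]
    exact Nat.div_eq_of_eq_mul_left (by norm_num) (by ring)
  have e6 : p * (q + 1) * (q - 1) / 4 = p * ((m + 1) * (m + 2)) := by
    rw [show q - 1 = 2 * (m + 1) by omega, show q + 1 = 2 * (m + 2) by omega]
    exact Nat.div_eq_of_eq_mul_left (by norm_num) (by ring)
  have h3 : q % 4 = 1 → _ := fun h4 => rho_psl2_card_add_one hp2 hFm hcop (hF ▸ h4)
  have h4 : q % 4 = 3 → _ := fun h4 => rho_psl2_card_sub_one hp2 hFm hcop (hF ▸ h4)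
  rw [← show q + 1 = 2 * (m + 2) by omega, hF] at h3
  rw [← show q - 1 = 2 * (m + 1) by omega, hF] at h4
  have h5 := rho_psl2_char_mul_half_card_sub_one hFm hcop
  have h6 := rho_psl2_char_mul_half_card_add_one hFm hcop
  have h7 := rho_psl2_semisimple hFm hcop
  rw [hF] at h5 h6 h7
  rw [e1, e2, e3, e4, e5, e6]
  refine ⟨exponent_psl2 p hFm hcop, hF ▸ rho_psl2_half_card_sub_one hFm hcop,
    hF ▸ rho_psl2_half_card_add_one hFm hcop, fun h => ⟨h3 h, h3 h ▸ one_half_lt_of_three hx⟩,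
    fun h => ⟨h4 h, h4 h ▸ lt_one_half_of_three hx⟩, h5, h5 ▸ one_half_lt_char_mul_sub hx,
    h6, h6 ▸ one_half_lt_char_mul_add hx, h7, fun h => h7 ▸ one_half_lt_semisimple ?_⟩
  exact_mod_cast h

/-! ### From proportions to counterexamples -/

section Conjecture

lemma rho_le_one (k : ℕ) (G : Type*) [Group G] [Finite G] : rho k G ≤ 1 :=
  div_le_one_of_le₀ (Nat.cast_le.2 (Nat.card_le_card_of_injective _ Subtype.val_injective))
    (Nat.cast_nonneg _)

lemma rho_le_eps (k : ℕ) (G : Type) [hG : Group G] [Finite G] (h : ¬ Group.IsSolvable G) :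
    rho k G ≤ eps k := by
  refine le_csSup ⟨1, ?_⟩ ⟨G, hG, inferInstance, h, rfl⟩
  rintro r ⟨H, _, _, -, rfl⟩
  exact rho_le_one k H

lemma orderOf_prod_eq {G H : Type*} [Group G] [Group H] {k : ℕ} {g : G} {h : H}
    (hg : orderOf g ∣ k) (hh : orderOf h = k) : orderOf (g, h) = k := by
  rw [Prod.orderOf, hh, Nat.lcm_eq_right hg]

lemma rho_mul_rhoStar_le_rhoStar_prod (k : ℕ) (G H : Type*) [Group G] [Group H] [Finite G]
    [Finite H] : rho k G * rhoStar k H ≤ rhoStar k (G × H) := by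
  rw [rho, rhoStar, rhoStar, div_mul_div_comm, Nat.card_prod, Nat.cast_mul]
  refine div_le_div_of_nonneg_right ?_ (by positivity)
  rw [← Nat.cast_mul, ← Nat.card_prod, Nat.cast_le]
  refine Nat.card_le_card_of_injective
    (fun x : {g : G // orderOf g ∣ k} × {h : H // orderOf h = k} =>
      (⟨(x.1.1, x.2.1), orderOf_prod_eq x.1.2 x.2.2⟩ : {y : G × H // orderOf y = k})) ?_
  rintro ⟨⟨a, _⟩, ⟨b, _⟩⟩ ⟨⟨c, _⟩, ⟨d, _⟩⟩ h
  simpa using h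

lemma orderOf_pi_eq_of_exists {k r : ℕ} {x : Fin r → Multiplicative (ZMod k)}
    (hx : ∃ i, x i = Multiplicative.ofAdd 1) : orderOf x = k := by
  obtain ⟨i, hi⟩ := hx
  refine Nat.dvd_antisymm (orderOf_dvd_of_pow_eq_one (funext fun j => ?_)) ?_
  · apply Multiplicative.toAdd.injective
    simp
  · have h1 : orderOf (x i) ∣ orderOf x := orderOf_map_dvd (Pi.evalMonoidHom _ i) x
    rwa [hi, orderOf_ofAdd_eq_addOrderOf, ZMod.addOrderOf_one] at h1

/-- A tuple can fail to have order `k` only if every coordinate avoids the generator `1`, leaving at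
most `(k - 1) ^ r` failures. -/
lemma one_sub_le_rhoStar_pi {k : ℕ} [NeZero k] (r : ℕ) :
    1 - (1 - 1 / (k : ℝ)) ^ r ≤ rhoStar k (Fin r → Multiplicative (ZMod k)) := by
  classical
  have hk : (k : ℝ) ≠ 0 := Nat.cast_ne_zero.2 (NeZero.ne k)
  set A := Multiplicative (ZMod k)
  have hA : Fintype.card A = k := (Fintype.card_multiplicative _).trans (ZMod.card k)
  have hle : k ^ r ≤ Nat.card {x : Fin r → A // orderOf x = k} + (k - 1) ^ r := by
    have h1 : Fintype.card {x : Fin r → A // ¬ orderOf x = k} ≤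
        Fintype.card (Fin r → {a : A // a ≠ Multiplicative.ofAdd 1}) := by
      refine Fintype.card_le_of_injective (fun x i => ⟨x.1 i, fun h =>
        x.2 (orderOf_pi_eq_of_exists ⟨i, h⟩)⟩) fun x y h => Subtype.ext (funext fun i => ?_)
      exact congrArg Subtype.val (congrFun h i)
    have h2 := Fintype.card_subtype_compl (fun x : Fin r → A => orderOf x = k)
    have h3 := Fintype.card_subtype_le (fun x : Fin r → A => orderOf x = k)
    have hne : Fintype.card {a : A // a ≠ Multiplicative.ofAdd 1} = k - 1 := by
      refine (Fintype.card_subtype_compl (fun a : A => a = Multiplicative.ofAdd 1)).trans ?_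
      rw [Fintype.card_subtype_eq, hA]
    rw [Fintype.card_fun, Fintype.card_fin, hne] at h1
    rw [Fintype.card_fun, Fintype.card_fin, hA] at h2 h3
    rw [Nat.card_eq_fintype_card]
    omega
  have hcard : Nat.card (Fin r → A) = k ^ r := by
    rw [Nat.card_eq_fintype_card, Fintype.card_fun, Fintype.card_fin, hA]
  rw [rhoStar, hcard, Nat.cast_pow, le_div_iff₀ (by positivity), sub_mul, ← mul_pow, sub_mul,
    one_div, inv_mul_cancel₀ hk, one_mul, one_mul, sub_le_iff_le_add]
  have := (Nat.cast_le (α := ℝ)).2 hle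
  rwa [Nat.cast_add, Nat.cast_pow, Nat.cast_pow, Nat.cast_sub (NeZero.one_le), Nat.cast_one]
    at this

/-- If a finite non-soluble group has more than half of its elements of order dividing `k`, then
its product with a large power of the cyclic group of order `k` has at least half of its elements
of order exactly `k`. -/
lemma not_deaconescuConjecture_of_one_half_lt_rho {k : ℕ} (hk : k ≠ 0) (G : Type) [Group G]
    [Finite G] (hG : ¬ Group.IsSolvable G) (h : 1 / 2 < rho k G) :
    ¬ DeaconescuConjecture k := by
  have := NeZero.mk hk
  have hk1 : (1 : ℝ) ≤ k := by exact_mod_cast Nat.one_le_iff_ne_zero.2 hk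
  have hlim : Filter.Tendsto (fun r : ℕ => rho k G * (1 - (1 - 1 / (k : ℝ)) ^ r)) Filter.atTop
      (nhds (rho k G * (1 - 0))) := by
    refine ((tendsto_pow_atTop_nhds_zero_of_lt_one ?_ ?_).const_sub 1).const_mul _
    · rw [sub_nonneg, div_le_one (by linarith)]; exact hk1
    · have : 0 < 1 / (k : ℝ) := by positivity
      linarith
  rw [sub_zero, mul_one] at hlim
  obtain ⟨r, hr⟩ := (hlim.eventually_const_lt h).exists
  intro hc
  have hs := hc (G × (Fin r → Multiplicative (ZMod k)))
    (hr.le.trans ((mul_le_mul_of_nonneg_left (one_sub_le_rhoStar_pi r) (by linarith)).trans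
      (rho_mul_rhoStar_le_rhoStar_prod k _ _)))
  exact hG (Group.isSolvable_of_surjective 
    (f := MonoidHom.fst G (Fin r → Multiplicative (ZMod k))) Prod.fst_surjective)

lemma fails_of_one_half_lt_rho {k : ℕ} (hk : k ≠ 0) (G : Type) [Group G]
    [Finite G] (hG : ¬ Group.IsSolvable G) (h : 1 / 2 < rho k G) :
    1 / 2 < eps k ∧ ¬ DeaconescuConjecture k :=
  ⟨h.trans_le (rho_le_eps k G hG), not_deaconescuConjecture_of_one_half_lt_rho hk G hG h⟩

lemma not_isSolvable_psl2 (F : Type*) [Field F] (hF : 4 ≤ Nat.card F) :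
    ¬ Group.IsSolvable PSL(2, F) := by
  classical
  have : Finite F := (Nat.card_pos_iff.1 (by omega)).2
  -- Such an `a` is what perfectness requires; only `0`, `1` and `-1` are excluded, and `F` has a
  -- fourth element.
  have ha : ∃ a : F, a ≠ 0 ∧ a ^ 2 ≠ 1 := by
    by_contra! h
    have hsub : (Set.univ : Set F) ⊆ ({0, 1, -1} : Finset F) := fun a _ => by
      by_cases h0 : a = 0
      · simp [h0]
      · simp [sq_eq_one_iff.1 (h a h0)]
    have := Set.ncard_le_ncard hsub
    rw [Set.ncard_univ, Set.ncard_coe_finset] at this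
    have := Finset.card_le_three (a := (0 : F)) (b := 1) (c := -1)
    omega
  have : Group.IsPerfect PSL(2, F) := ⟨SL2Simple.PSL_commutator_eq_top ha⟩
  exact Group.IsPerfect.not_isSolvable _

end Conjecture

/-- Without the summand `2` in the numerators the quotients are `1 / 2 - 1 / (x - 1)` and `1 / 2 - 1
/ (x + 1)`. -/
lemma one_half_sub_lt_of_large {δ x : ℝ} (hx : 3 ≤ x) (h : 2 < δ * (x - 1)) :
    1 / 2 - δ < (x * (x + 1) * (x - 3) / 2 + 2) / ((x - 1) * x * (x + 1)) ∧
    1 / 2 - δ < (x * (x - 1) ^ 2 / 2 + 2) / ((x - 1) * x * (x + 1)) := by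
  have h0 : 0 < x * (x + 1) := mul_pos (by linarith) (by linarith)
  have h1 : 0 < (x - 1) * x * (x + 1) := by
    rw [mul_assoc]; exact mul_pos (by linarith) h0
  have h2 := mul_lt_mul_of_pos_right h h0
  rw [lt_div_iff₀ h1, lt_div_iff₀ h1]
  constructor <;> nlinarith

theorem proposition3p3 :
    -- the explicit values of the exponent and of the ratios
    (∀ (p n q : ℕ), p.Prime → p ≠ 2 → 1 ≤ n → q = p ^ n →
      ∀ (F : Type*) [Field F] [Finite F], Nat.card F = q →
        Monoid.exponent (Matrix.ProjectiveSpecialLinearGroup (Fin 2) F)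
            = p * (q + 1) * (q - 1) / 4 ∧
        rho ((q - 1) / 2) (Matrix.ProjectiveSpecialLinearGroup (Fin 2) F)
            = ((q : ℝ) * (q + 1) * (q - 3) / 2 + 2) / (((q : ℝ) - 1) * q * (q + 1)) ∧
        rho ((q + 1) / 2) (Matrix.ProjectiveSpecialLinearGroup (Fin 2) F)
            = ((q : ℝ) * (q - 1) ^ 2 / 2 + 2) / (((q : ℝ) - 1) * q * (q + 1)) ∧
        (q % 4 = 1 →
          rho (q + 1) (Matrix.ProjectiveSpecialLinearGroup (Fin 2) F)
            = ((q : ℝ) ^ 3 + 3 * q + 4) / (2 * ((q : ℝ) - 1) * q * (q + 1)) ∧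
          1 / 2 < rho (q + 1) (Matrix.ProjectiveSpecialLinearGroup (Fin 2) F)) ∧
        (q % 4 = 3 →
          rho (q - 1) (Matrix.ProjectiveSpecialLinearGroup (Fin 2) F)
            = ((q : ℝ) ^ 3 - 5 * q + 4) / (2 * ((q : ℝ) - 1) * q * (q + 1)) ∧
          rho (q - 1) (Matrix.ProjectiveSpecialLinearGroup (Fin 2) F) < 1 / 2) ∧
        rho (p * (q - 1) / 2) (Matrix.ProjectiveSpecialLinearGroup (Fin 2) F)
            = ((q : ℝ) * ((q : ℝ) ^ 2 + 2 * q - 3)) / (2 * ((q : ℝ) - 1) * q * (q + 1)) ∧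
        1 / 2 < rho (p * (q - 1) / 2) (Matrix.ProjectiveSpecialLinearGroup (Fin 2) F) ∧
        rho (p * (q + 1) / 2) (Matrix.ProjectiveSpecialLinearGroup (Fin 2) F)
            = ((q : ℝ) * ((q : ℝ) + 1) ^ 2) / (2 * ((q : ℝ) - 1) * q * (q + 1)) ∧
        1 / 2 < rho (p * (q + 1) / 2) (Matrix.ProjectiveSpecialLinearGroup (Fin 2) F) ∧
        rho ((q - 1) * (q + 1) / 4) (Matrix.ProjectiveSpecialLinearGroup (Fin 2) F)
            = ((q : ℝ) - 2) / q ∧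
        (5 ≤ q →
          1 / 2 < rho ((q - 1) * (q + 1) / 4)
            (Matrix.ProjectiveSpecialLinearGroup (Fin 2) F))) ∧
    -- lower bounds close to one half for `k = (q ± 1) / 2`
    (∀ δ : ℝ, 0 < δ → ∃ M : ℕ, 0 < M ∧
      ∀ (p n q : ℕ), p.Prime → p ≠ 2 → 1 ≤ n → q = p ^ n → M < q →
        1 / 2 - δ < eps ((q - 1) / 2) ∧ 1 / 2 - δ < eps ((q + 1) / 2)) ∧
    -- values of `k` for which the conjecture fails
    (∀ (p n q : ℕ), p.Prime → p ≠ 2 → 1 ≤ n → q = p ^ n →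
      (q % 4 = 1 → 1 / 2 < eps (q + 1) ∧ ¬ DeaconescuConjecture (q + 1)) ∧
      (1 / 2 < eps (p * (q + 1) / 2) ∧ ¬ DeaconescuConjecture (p * (q + 1) / 2)) ∧
      (5 ≤ q →
        (1 / 2 < eps (p * (q - 1) / 2) ∧ ¬ DeaconescuConjecture (p * (q - 1) / 2)) ∧
        (1 / 2 < eps ((q - 1) * (q + 1) / 4) ∧
          ¬ DeaconescuConjecture ((q - 1) * (q + 1) / 4)))) := by
  have hfield (p n q : ℕ) (hp : p.Prime) (hn : 1 ≤ n) (hq : q = p ^ n) :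
      ∃ (F : Type) (_ : Field F), Finite F ∧ Nat.card F = q := by
    have := Fact.mk hp
    exact ⟨GaloisField p n, inferInstance, inferInstance, by
      rw [GaloisField.card p n (by omega), hq]⟩
  refine ⟨fun p n q hp hp2 hn hq F _ _ hF => psl2_values p n q hp hp2 hn hq F hF,
    fun δ hδ => ?_, fun p n q hp hp2 hn hq => ?_⟩
  · obtain ⟨M, hM⟩ := exists_nat_gt (2 / δ)
    -- The extra `4` guarantees `q ≥ 4`, hence non-solubility.
    refine ⟨M + 4, by omega, fun p n q hp hp2 hn hq hMq => ?_⟩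
    obtain ⟨F, _, _, hF⟩ := hfield p n q hp hn hq
    obtain ⟨-, h1, h2, -⟩ := psl2_values p n q hp hp2 hn hq F hF
    have hG := not_isSolvable_psl2 F (by omega)
    have hqM : (M : ℝ) + 4 < q := by exact_mod_cast hMq
    have hM0 : (0 : ℝ) ≤ M := Nat.cast_nonneg M
    rw [div_lt_iff₀ hδ] at hM
    have hb := one_half_sub_lt_of_large (δ := δ) (x := q) (by linarith) (by nlinarith)
    exact ⟨(h1 ▸ hb.1).trans_le (rho_le_eps _ _ hG), (h2 ▸ hb.2).trans_le (rho_le_eps _ _ hG)⟩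
  · obtain ⟨m, hm, -⟩ := exists_eq_two_mul_add_three hp hp2 hn hq
    obtain ⟨F, _, _, hF⟩ := hfield p n q hp hn hq
    obtain ⟨-, -, -, h3, -, -, h5, -, h6, -, h7⟩ := psl2_values p n q hp hp2 hn hq F hF
    have hG (h : 5 ≤ q) := not_isSolvable_psl2 F (by omega)
    have hdiv {a b : ℕ} (hb : 2 ≤ b) (ha : 0 < a) : a * b / 2 ≠ 0 :=
      (Nat.div_pos (hb.trans (Nat.le_mul_of_pos_left b ha)) two_pos).ne'
    refine ⟨fun h => fails_of_one_half_lt_rho (by omega) _ (hG (by omega)) (h3 h).2, ?_,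
      fun h => ⟨fails_of_one_half_lt_rho (hdiv (by omega) hp.pos) _ (hG h) h5,
        fails_of_one_half_lt_rho ?_ _ (hG h) (h7 h)⟩⟩
    · by_cases h : 5 ≤ q
      · exact fails_of_one_half_lt_rho (hdiv (by omega) hp.pos) _ (hG h) h6
      -- The group for `q = 3` is soluble, but then `k = 3 * 4 / 2 = 6 = 5 + 1`, so the field of
      -- five elements and the case `q % 4 = 1` supply the counterexample.
      · have hq3 : q = 3 := by omega
        have hp3 : p = 3 := by
          have : p ∣ 3 := hq3 ▸ hq ▸ dvd_pow_self p (by omega)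
          exact (Nat.prime_dvd_prime_iff_eq hp Nat.prime_three).1 this
        obtain ⟨E, _, _, hE⟩ := hfield 5 1 5 Nat.prime_five le_rfl rfl
        obtain ⟨-, -, -, h35, -⟩ :=
          psl2_values 5 1 5 Nat.prime_five (by norm_num) le_rfl rfl E hE
        subst hq3 hp3
        exact fails_of_one_half_lt_rho (by norm_num) _ (not_isSolvable_psl2 E (by omega))
          (h35 (by norm_num)).2
    · exact (Nat.div_pos (Nat.mul_le_mul (show 2 ≤ q - 1 by omega) (show 2 ≤ q + 1 by omega))
        (by norm_num)).ne'
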